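/- Let $T_1=\{3214,3241,4213,4231\}$ and $T_2=\{3124,3142,4123,4132\}$. For $i\in\{1,2\}$ let $S_n(T_i)$ be the set of permutations of $\{1,\dots,n\}$ that avoid all the patterns in $T_i$, and let $$H_i(x,y)=\sum_{n\ge 1}\ \sum_{\sigma\in S_n(T_i)}x^n y^{\sigma(1)}$$ be the generating function of these permutations by length and first element. Then, as formal power series in $x$ and $y$ over $\mathbb{Q}$, $$H_1(x,y)=H_2(x,y)=\frac{xy\left[(xy-1)^2(1-y)\sqrt{1-4x}+x(1-2xy)\right]}{(1-y+xy^2)(1-2xy)\sqrt{1-4x}},$$ where $\sqrt{1-4x}$ is the unique formal power series with constant term $1$ whose square is $1-4x$; the denominator is invertible in the ring of formal power series. -/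

import Mathlib

namespace FirstElement

/-- The permutation `σ` of an `n`-element chain contains the pattern `τ(1) τ(2) … τ(k)` (a word
with distinct letters): some subsequence of `σ(1) … σ(n)` is order isomorphic to `τ`. -/
def Contains {n k : ℕ} (σ : Equiv.Perm (Fin n)) (τ : Fin k → ℕ) : Prop :=
  ∃ f : Fin k → Fin n, StrictMono f ∧ ∀ i j, σ (f i) < σ (f j) ↔ τ i < τ j

/-- `σ` avoids every pattern in `T`. -/
def Avoids {n k : ℕ} (σ : Equiv.Perm (Fin n)) (T : Set (Fin k → ℕ)) : Prop :=
  ∀ τ ∈ T, ¬ Contains σ τ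

/-- The patterns `3214, 3241, 4213, 4231`. -/
def T₁ : Set (Fin 4 → ℕ) := {![3, 2, 1, 4], ![3, 2, 4, 1], ![4, 2, 1, 3], ![4, 2, 3, 1]}

/-- The patterns `3124, 3142, 4123, 4132`. -/
def T₂ : Set (Fin 4 → ℕ) := {![3, 1, 2, 4], ![3, 1, 4, 2], ![4, 1, 2, 3], ![4, 1, 3, 2]}

/-- The first element of `σ` is `k`. As `Fin n` is `{0, …, n - 1}`, the symbol `v` of `Fin n` stands
for the symbol `v + 1` of `{1, …, n}`. For `n = 0` there is no first element. -/
def HasHead {n : ℕ} (σ : Equiv.Perm (Fin n)) (k : ℕ) : Prop :=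
  ∃ h : 0 < n, (σ ⟨0, h⟩ : ℕ) + 1 = k

/-- The number of permutations of length `n` that avoid `T` and have first element `k`. -/
noncomputable def headCount {l : ℕ} (T : Set (Fin l → ℕ)) (n k : ℕ) : ℕ :=
  {σ : Equiv.Perm (Fin n) | Avoids σ T ∧ HasHead σ k}.ncard

/-- The formal power series in the variables `X 0` (length) and `X 1` (first element) whose
coefficient at `(X 0) ^ n * (X 1) ^ k` is `headCount T n k`. -/
noncomputable def headSeries {l : ℕ} (T : Set (Fin l → ℕ)) : MvPowerSeries (Fin 2) ℚ :=
  fun m => (headCount T (m 0) (m 1) : ℚ)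

/-- The first variable `x`. -/
noncomputable def x : MvPowerSeries (Fin 2) ℚ := MvPowerSeries.X 0

/-- The second variable `y`. -/
noncomputable def y : MvPowerSeries (Fin 2) ℚ := MvPowerSeries.X 1

/-- `r` is the formal power series `√(1 - 4x)`: the square root of `1 - 4x` with constant
term `1`. -/
def IsSqrtOneSubFourX (r : MvPowerSeries (Fin 2) ℚ) : Prop :=
  r ^ 2 = 1 - 4 * x ∧ MvPowerSeries.constantCoeff r = 1

end FirstElement

/-! Both pattern sets forbid a configuration `a … b … {c, d}` in which `a b` is a descent and the
last two letters come in either order. Such a condition survives raising `a`, so only the larger of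
the first two letters matters as a possible `a`. If the word starts with an ascent, its first letter
can be deleted; if it starts with a descent `k v`, then `v` can be deleted, and the only new
constraint is on the pair of values `k`, `v`, since all other letters come later
(`forkCount_succ_succ`). For both sets the number of admissible `v` is the same (`IsTame`), hence
`H₁ = H₂`.

Differencing in `k` gives `f(n, k+2) - f(n, k+1) + f(n-1, k) = 0` off the diagonal, a functional
equation with kernel `1 - y + x * y ^ 2` and unknown `y ^ 1` column. Instead of substituting the
kernel root `y = C(x)` (Catalan series), the proof checks that the closed form satisfies the same
equation and invokes uniqueness (`eq_zero_of_kernel_mul`). Uniqueness needs support in `k ≤ n`; for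
the closed form this appears after cancelling the factor `1 - y / C` (`kernel_eq`, `numerator_eq`).
-/

namespace FirstElement

/-! ### Pattern avoidance as fork-freeness -/

/-- The order embedding of `ℕ` into itself that omits the value `v`. -/
def bump (v a : ℕ) : ℕ := if a < v then a else a + 1

theorem bump_lt_bump {v a b : ℕ} : bump v a < bump v b ↔ a < b := by
  unfold bump; split_ifs <;> omega

theorem lt_bump_iff {v a : ℕ} : v < bump v a ↔ v ≤ a := by
  unfold bump; split_ifs <;> omega

theorem val_succAbove {n : ℕ} (v : Fin (n + 1)) (a : Fin n) :
    (v.succAbove a : ℕ) = bump v a := by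
  simp only [Fin.succAbove, bump, Fin.lt_def, Fin.val_castSucc]
  split_ifs <;> simp

/-- A relation `R a b c d` between the values of the letters `a … b …{c, d}` of a pattern in which
`a b` is a descent, such that `R` depends on the relative order only and is increasing in `a`. -/
structure IsForkRelation (R : ℕ → ℕ → ℕ → ℕ → Prop) : Prop where
  lt : ∀ {a b c d}, R a b c d → b < a
  ne_left : ∀ {a b c d}, R a b c d → c ≠ b
  ne_right : ∀ {a b c d}, R a b c d → d ≠ b
  mono : ∀ {a a' b c d}, a ≤ a' → R a b c d → R a' b c d
  bump_iff : ∀ {v a b c d}, R (bump v a) (bump v b) (bump v c) (bump v d) ↔ R a b c d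

/-- The permutation `σ` has no occurrence `a … b …{c, d}` of a pattern satisfying `R`. -/
def ForkFree (R : ℕ → ℕ → ℕ → ℕ → Prop) {n : ℕ} (σ : Equiv.Perm (Fin n)) : Prop :=
  ∀ i j l m : Fin n, i < j → j < l → j < m → ¬ R (σ i) (σ j) (σ l) (σ m)

/-- The relation that describes the patterns in `T₁`. -/
def Fork₁ (a b c d : ℕ) : Prop := c < b ∧ b < d ∧ b < a

/-- The relation that describes the patterns in `T₂`. -/
def Fork₂ (a b c d : ℕ) : Prop := b < c ∧ c < a ∧ c < d

theorem isForkRelation_fork₁ : IsForkRelation Fork₁ where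
  lt h := h.2.2
  ne_left h := h.1.ne
  ne_right h := h.2.1.ne'
  mono h h' := ⟨h'.1, h'.2.1, h'.2.2.trans_le h⟩
  bump_iff := by simp [Fork₁, bump_lt_bump]

theorem isForkRelation_fork₂ : IsForkRelation Fork₂ where
  lt h := h.1.trans h.2.1
  ne_left h := h.1.ne'
  ne_right h := (h.1.trans h.2.2).ne'
  mono h h' := ⟨h'.1, h'.2.1.trans_le h, h'.2.2⟩
  bump_iff := by simp [Fork₂, bump_lt_bump]

theorem contains_of {n : ℕ} {σ : Equiv.Perm (Fin n)} {τ : Fin 4 → ℕ} {a b c d : Fin n}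
    (hab : a < b) (hbc : b < c) (hcd : c < d)
    (h : ∀ i j, σ (![a, b, c, d] i) < σ (![a, b, c, d] j) ↔ τ i < τ j) : Contains σ τ := by
  refine ⟨![a, b, c, d], ?_, h⟩
  rw [Fin.strictMono_iff_lt_succ]
  intro i
  fin_cases i <;> simpa

theorem Contains.exists_four {n : ℕ} {σ : Equiv.Perm (Fin n)} {τ : Fin 4 → ℕ}
    (h : Contains σ τ) : ∃ a b c d : Fin n, a < b ∧ b < c ∧ c < d ∧
      ∀ i j, σ (![a, b, c, d] i) < σ (![a, b, c, d] j) ↔ τ i < τ j := by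
  obtain ⟨f, hf, h⟩ := h
  refine ⟨f 0, f 1, f 2, f 3, hf (by decide), hf (by decide), hf (by decide), fun i j => ?_⟩
  rw [← h i j]
  fin_cases i <;> fin_cases j <;> rfl

theorem contains_iff {n : ℕ} {σ : Equiv.Perm (Fin n)} {τ : Fin 4 → ℕ} :
    Contains σ τ ↔ ∃ a b c d : Fin n, a < b ∧ b < c ∧ c < d ∧
      ∀ i j, σ (![a, b, c, d] i) < σ (![a, b, c, d] j) ↔ τ i < τ j :=
  ⟨Contains.exists_four, fun ⟨_, _, _, _, h₁, h₂, h₃, h⟩ => contains_of h₁ h₂ h₃ h⟩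

theorem apply_ne {n : ℕ} (σ : Equiv.Perm (Fin n)) {i j : Fin n} (h : i < j) :
    (σ i : ℕ) ≠ σ j := fun e => h.ne (σ.injective (Fin.ext e))

theorem contains_iff_of_forall {n : ℕ} {σ : Equiv.Perm (Fin n)} {τ : Fin 4 → ℕ}
    {Q : ℕ → ℕ → ℕ → ℕ → Prop}
    (hQ : ∀ p : Fin 4 → ℕ, (∀ i j, p i < p j ↔ τ i < τ j) ↔ Q (p 0) (p 1) (p 2) (p 3)) :
    Contains σ τ ↔ ∃ a b c d : Fin n, a < b ∧ b < c ∧ c < d ∧ Q (σ a) (σ b) (σ c) (σ d) := by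
  rw [contains_iff]
  refine exists₄_congr fun a b c d => and_congr_right fun _ => and_congr_right fun _ =>
    and_congr_right fun _ => ?_
  exact hQ (fun i => σ (![a, b, c, d] i))

/-- The four words come from two independent choices: which of `c`, `d` stands first, and whether
`a` is below or above `d`. -/
theorem avoids_T₁_iff {n : ℕ} (σ : Equiv.Perm (Fin n)) : Avoids σ T₁ ↔ ForkFree Fork₁ σ := by
  have h₁ : Contains σ ![3, 2, 1, 4] ↔ _ := contains_iff_of_forall
    (Q := fun p q r s => r < q ∧ q < p ∧ p < s) fun p => by
      simp [Fin.forall_fin_succ]; omega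
  have h₂ : Contains σ ![3, 2, 4, 1] ↔ _ := contains_iff_of_forall
    (Q := fun p q r s => s < q ∧ q < p ∧ p < r) fun p => by
      simp [Fin.forall_fin_succ]; omega
  have h₃ : Contains σ ![4, 2, 1, 3] ↔ _ := contains_iff_of_forall
    (Q := fun p q r s => r < q ∧ q < s ∧ s < p) fun p => by
      simp [Fin.forall_fin_succ]; omega
  have h₄ : Contains σ ![4, 2, 3, 1] ↔ _ := contains_iff_of_forall
    (Q := fun p q r s => s < q ∧ q < r ∧ r < p) fun p => by
      simp [Fin.forall_fin_succ]; omega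
  simp only [Avoids, T₁, Set.mem_insert_iff, Set.mem_singleton_iff, forall_eq_or_imp, forall_eq,
    h₁, h₂, h₃, h₄]
  constructor
  · rintro ⟨h₁, h₂, h₃, h₄⟩ a b l m hab hbl hbm ⟨hlb, hbm', hba⟩
    have hne := apply_ne σ (hab.trans hbm)
    rcases lt_trichotomy l m with hlm | rfl | hml
    · rcases hne.lt_or_gt with h | h
      · exact h₁ ⟨a, b, l, m, hab, hbl, hlm, hlb, hba, h⟩
      · exact h₃ ⟨a, b, l, m, hab, hbl, hlm, hlb, hbm', h⟩
    · omega
    · rcases hne.lt_or_gt with h | h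
      · exact h₂ ⟨a, b, m, l, hab, hbm, hml, hlb, hba, h⟩
      · exact h₄ ⟨a, b, m, l, hab, hbm, hml, hlb, hbm', h⟩
  · intro h
    refine ⟨?_, ?_, ?_, ?_⟩ <;> rintro ⟨a, b, c, d, hab, hbc, hcd, hr⟩
    · exact h a b c d hab hbc (hbc.trans hcd) ⟨by omega, by omega, by omega⟩
    · exact h a b d c hab (hbc.trans hcd) hbc ⟨by omega, by omega, by omega⟩
    · exact h a b c d hab hbc (hbc.trans hcd) ⟨by omega, by omega, by omega⟩
    · exact h a b d c hab (hbc.trans hcd) hbc ⟨by omega, by omega, by omega⟩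

/-- As for `T₁`: the choices are the order of `c`, `d` in position and of `a`, `d` in value. -/
theorem avoids_T₂_iff {n : ℕ} (σ : Equiv.Perm (Fin n)) : Avoids σ T₂ ↔ ForkFree Fork₂ σ := by
  have h₁ : Contains σ ![3, 1, 2, 4] ↔ _ := contains_iff_of_forall
    (Q := fun p q r s => q < r ∧ r < p ∧ p < s) fun p => by
      simp [Fin.forall_fin_succ]; omega
  have h₂ : Contains σ ![3, 1, 4, 2] ↔ _ := contains_iff_of_forall
    (Q := fun p q r s => q < s ∧ s < p ∧ p < r) fun p => by
      simp [Fin.forall_fin_succ]; omega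
  have h₃ : Contains σ ![4, 1, 2, 3] ↔ _ := contains_iff_of_forall
    (Q := fun p q r s => q < r ∧ r < s ∧ s < p) fun p => by
      simp [Fin.forall_fin_succ]; omega
  have h₄ : Contains σ ![4, 1, 3, 2] ↔ _ := contains_iff_of_forall
    (Q := fun p q r s => q < s ∧ s < r ∧ r < p) fun p => by
      simp [Fin.forall_fin_succ]; omega
  simp only [Avoids, T₂, Set.mem_insert_iff, Set.mem_singleton_iff, forall_eq_or_imp, forall_eq,
    h₁, h₂, h₃, h₄]
  constructor
  · rintro ⟨h₁, h₂, h₃, h₄⟩ a b l m hab hbl hbm ⟨hbl', hla, hlm'⟩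
    have hne := apply_ne σ (hab.trans hbm)
    rcases lt_trichotomy l m with hlm | rfl | hml
    · rcases hne.lt_or_gt with h | h
      · exact h₁ ⟨a, b, l, m, hab, hbl, hlm, hbl', hla, h⟩
      · exact h₃ ⟨a, b, l, m, hab, hbl, hlm, hbl', hlm', h⟩
    · omega
    · rcases hne.lt_or_gt with h | h
      · exact h₂ ⟨a, b, m, l, hab, hbm, hml, hbl', hla, h⟩
      · exact h₄ ⟨a, b, m, l, hab, hbm, hml, hbl', hlm', h⟩
  · intro h
    refine ⟨?_, ?_, ?_, ?_⟩ <;> rintro ⟨a, b, c, d, hab, hbc, hcd, hr⟩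
    · exact h a b c d hab hbc (hbc.trans hcd) ⟨by omega, by omega, by omega⟩
    · exact h a b d c hab (hbc.trans hcd) hbc ⟨by omega, by omega, by omega⟩
    · exact h a b c d hab hbc (hbc.trans hcd) ⟨by omega, by omega, by omega⟩
    · exact h a b d c hab (hbc.trans hcd) hbc ⟨by omega, by omega, by omega⟩

/-! ### Inserting and deleting a letter -/

/-- The permutation obtained from `σ` by inserting a new letter of value `v` at position `i`. -/
def insertAt {n : ℕ} (i v : Fin (n + 1)) (σ : Equiv.Perm (Fin n)) : Equiv.Perm (Fin (n + 1)) :=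
  (finSuccEquiv' i).trans ((Equiv.optionCongr σ).trans (finSuccEquiv' v).symm)

@[simp]
theorem insertAt_self {n : ℕ} (i v : Fin (n + 1)) (σ : Equiv.Perm (Fin n)) :
    insertAt i v σ i = v := by simp [insertAt]

@[simp]
theorem insertAt_succAbove {n : ℕ} (i v : Fin (n + 1)) (σ : Equiv.Perm (Fin n))
    (p : Fin n) : insertAt i v σ (i.succAbove p) = v.succAbove (σ p) := by simp [insertAt]

theorem insertAt_injective {n : ℕ} (i v : Fin (n + 1)) :
    Function.Injective (insertAt i v) := by
  intro σ τ h
  ext p : 1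
  apply Fin.succAbove_right_injective (p := v)
  rw [← insertAt_succAbove i, h, insertAt_succAbove]

theorem exists_insertAt_eq {n : ℕ} {i v : Fin (n + 1)} {σ : Equiv.Perm (Fin (n + 1))}
    (h : σ i = v) : ∃ τ, insertAt i v τ = σ := by
  refine ⟨(finSuccAboveEquiv i).trans ((σ.subtypeEquiv fun a => ?_).trans
    (finSuccAboveEquiv v).symm), ?_⟩
  · rw [← h, σ.injective.ne_iff]
  · ext q : 1
    rcases Fin.eq_self_or_eq_succAbove i q with rfl | ⟨p, rfl⟩
    · simp [h]
    · rw [insertAt_succAbove]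
      generalize hq : (Equiv.trans (finSuccAboveEquiv i) _) p = q
      simp only [Equiv.trans_apply, Equiv.symm_apply_eq] at hq
      exact (congrArg Subtype.val hq).symm

variable {R : ℕ → ℕ → ℕ → ℕ → Prop}

theorem ForkFree.of_insertAt (hR : IsForkRelation R) {n : ℕ} {i v : Fin (n + 1)}
    {σ : Equiv.Perm (Fin n)} (h : ForkFree R (insertAt i v σ)) : ForkFree R σ := by
  intro a b c d hab hbc hbd hr
  refine h (i.succAbove a) (i.succAbove b) (i.succAbove c) (i.succAbove d) ?_ ?_ ?_ ?_
  · simpa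
  · simpa
  · simpa
  · simpa [val_succAbove, hR.bump_iff]

theorem forkFree_insertAt_zero (hR : IsForkRelation R) {n : ℕ} {v : Fin (n + 2)}
    {σ : Equiv.Perm (Fin (n + 1))} (hv : (v : ℕ) ≤ σ 0) :
    ForkFree R (insertAt 0 v σ) ↔ ForkFree R σ := by
  refine ⟨ForkFree.of_insertAt hR, fun h a b c d hab hbc hbd hr => ?_⟩
  obtain ⟨b, rfl⟩ := Fin.exists_succ_eq_of_ne_zero (Fin.ne_zero_of_lt hab)
  obtain ⟨c, rfl⟩ := Fin.exists_succ_eq_of_ne_zero (Fin.ne_zero_of_lt hbc)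
  obtain ⟨d, rfl⟩ := Fin.exists_succ_eq_of_ne_zero (Fin.ne_zero_of_lt hbd)
  simp only [← Fin.succAbove_zero, insertAt_succAbove, val_succAbove] at hr
  rw [Fin.succ_lt_succ_iff] at hbc hbd
  rcases Fin.eq_zero_or_eq_succ a with rfl | ⟨a, rfl⟩
  · rw [insertAt_self] at hr
    -- The old first letter is larger than the new one, so it can replace it as `a`.
    have hlt : (v : ℕ) < bump v (σ 0) := lt_bump_iff.2 hv
    have hr' := hR.bump_iff.1 (hR.mono hlt.le hr)
    refine h 0 b c d ?_ hbc hbd hr'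
    rw [Fin.pos_iff_ne_zero]
    rintro rfl
    exact (hR.lt hr').false
  · rw [Fin.succ_lt_succ_iff] at hab
    simp only [← Fin.succAbove_zero, insertAt_succAbove, val_succAbove, hR.bump_iff] at hr
    exact h a b c d hab hbc hbd hr

/-- The first two letters become the descent `σ 0 + 1`, `v`. An occurrence with `v` as `a` can use
the larger first letter instead, so only those with this descent as `a b` are new. -/
theorem forkFree_insertAt_one (hR : IsForkRelation R) {n : ℕ} {v : Fin (n + 2)}
    {σ : Equiv.Perm (Fin (n + 1))} (hv : (v : ℕ) ≤ σ 0) :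
    ForkFree R (insertAt 1 v σ) ↔ ForkFree R σ ∧
      ∀ c d, c < n + 2 → d < n + 2 → c ≠ σ 0 + 1 → d ≠ σ 0 + 1 → ¬ R (σ 0 + 1) v c d := by
  have h10 : (1 : Fin (n + 2)).succAbove 0 = 0 := rfl
  have h0 : (insertAt 1 v σ 0 : ℕ) = σ 0 + 1 := by
    rw [← h10, insertAt_succAbove, val_succAbove, bump, if_neg (by omega)]
  constructor
  · refine fun h => ⟨ForkFree.of_insertAt hR h, fun c d hc hd hck hdk hr => ?_⟩
    -- Every value other than the first two letters occurs after them, so positions drop out of the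
    -- condition.
    have key (c : ℕ) (hc : c < n + 2) (hck : c ≠ σ 0 + 1) (hcv : c ≠ v) :
        ∃ l, 1 < l ∧ (insertAt 1 v σ l : ℕ) = c := by
      obtain ⟨l, hl⟩ := (insertAt 1 v σ).surjective ⟨c, hc⟩
      refine ⟨l, ?_, by rw [hl]⟩
      rw [Fin.lt_def]
      by_contra! hle
      have : l = 0 ∨ l = 1 := by
        simp only [Fin.ext_iff, Fin.val_zero, Fin.val_one] at hle ⊢; omega
      rcases this with rfl | rfl
      · rw [hl] at h0; exact hck h0
      · rw [insertAt_self] at hl; exact hcv (by rw [hl])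
    obtain ⟨l, hl, rfl⟩ := key c hc hck (hR.ne_left hr)
    obtain ⟨m, hm, rfl⟩ := key d hd hdk (hR.ne_right hr)
    refine h 0 1 l m (by simp) hl hm ?_
    rwa [h0, insertAt_self]
  · rintro ⟨h, hk⟩ a b c d hab hbc hbd hr
    have hne (c : Fin (n + 2)) (h : 1 < c) : ∃ e, c = Fin.succAbove 1 e ∧ 0 < e := by
      obtain ⟨e, rfl⟩ := Fin.exists_succAbove_eq h.ne'
      refine ⟨e, rfl, Fin.pos_of_ne_zero ?_⟩
      rintro rfl
      rw [h10] at h; simp at h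
    have hval (e : Fin (n + 1)) (he : 0 < e) : bump v (σ e) ≠ σ 0 + 1 := by
      rw [← h0, ← val_succAbove, ← insertAt_succAbove 1]
      refine (apply_ne _ ?_).symm
      have := Fin.succAbove_lt_succAbove_iff (p := 1) |>.2 he
      rwa [h10] at this
    have hb1 : 1 ≤ b := by rw [Fin.lt_def] at hab; rw [Fin.le_def, Fin.val_one]; omega
    obtain ⟨c, rfl, hc⟩ := hne c (hb1.trans_lt hbc)
    obtain ⟨d, rfl, hd⟩ := hne d (hb1.trans_lt hbd)
    rcases hb1.eq_or_lt with rfl | hb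
    · have : a = 0 := by
        rw [Fin.lt_def, Fin.val_one] at hab; ext; rw [Fin.val_zero]; omega
      subst this
      rw [h0, insertAt_self, insertAt_succAbove, insertAt_succAbove] at hr
      refine hk _ _ (Fin.is_lt _) (Fin.is_lt _) ?_ ?_ hr
      · rw [val_succAbove]; exact hval c hc
      · rw [val_succAbove]; exact hval d hd
    · obtain ⟨b, rfl, hb'⟩ := hne b hb
      rw [Fin.succAbove_lt_succAbove_iff] at hbc hbd
      rcases eq_or_ne a 1 with rfl | ha
      · rw [insertAt_self] at hr
        have : (v : ℕ) ≤ bump v (σ 0) := (lt_bump_iff.2 hv).le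
        have hr := hR.mono this hr
        simp only [insertAt_succAbove, val_succAbove, hR.bump_iff] at hr
        exact h 0 b c d hb' hbc hbd hr
      · obtain ⟨a, rfl⟩ := Fin.exists_succAbove_eq ha
        simp only [insertAt_succAbove, val_succAbove, hR.bump_iff,
          Fin.succAbove_lt_succAbove_iff] at hr hab
        exact h a b c d hab hbc hbd hr

/-! ### The recursion on the first element -/

/-- The number of fork-free permutations of length `n` with first element `k`. -/
noncomputable def forkCount (R : ℕ → ℕ → ℕ → ℕ → Prop) (n k : ℕ) : ℕ :=
  {σ : Equiv.Perm (Fin n) | ForkFree R σ ∧ HasHead σ k}.ncard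

/-- The number of fork-free permutations of length `n` with first element greater than `k`. -/
noncomputable def tailCount (R : ℕ → ℕ → ℕ → ℕ → Prop) (n k : ℕ) : ℕ :=
  {σ : Equiv.Perm (Fin n) | ForkFree R σ ∧ ∃ j, k < j ∧ HasHead σ j}.ncard

/-- The letters `v < k` that can follow the first letter `k` in a fork-free permutation of
`{0, …, n + 1}`. -/
def descentValues (R : ℕ → ℕ → ℕ → ℕ → Prop) (n k : ℕ) : Set (Fin (n + 2)) :=
  {v | (v : ℕ) < k ∧ ∀ c d, c < n + 2 → d < n + 2 → c ≠ k → d ≠ k → ¬ R k v c d}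

theorem headCount_T₁ (n k : ℕ) : headCount T₁ n k = forkCount Fork₁ n k := by
  simp only [headCount, forkCount, avoids_T₁_iff]

theorem headCount_T₂ (n k : ℕ) : headCount T₂ n k = forkCount Fork₂ n k := by
  simp only [headCount, forkCount, avoids_T₂_iff]

theorem hasHead_succ {n k : ℕ} {σ : Equiv.Perm (Fin (n + 1))} :
    HasHead σ k ↔ (σ 0 : ℕ) + 1 = k :=
  ⟨fun ⟨_, h⟩ => h, fun h => ⟨n.succ_pos, h⟩⟩

theorem forkCount_zero_right (R : ℕ → ℕ → ℕ → ℕ → Prop) (n : ℕ) : forkCount R n 0 = 0 := by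
  rw [forkCount, Set.ncard_eq_zero]
  refine Set.eq_empty_of_forall_notMem fun σ ⟨_, h, h'⟩ => by omega

theorem forkCount_eq_zero_of_lt (R : ℕ → ℕ → ℕ → ℕ → Prop) {n k : ℕ} (h : n < k) :
    forkCount R n k = 0 := by
  rw [forkCount, Set.ncard_eq_zero]
  refine Set.eq_empty_of_forall_notMem fun σ ⟨_, h, h'⟩ => by omega

theorem tailCount_eq_zero_of_le (R : ℕ → ℕ → ℕ → ℕ → Prop) {n k : ℕ} (h : n ≤ k) :
    tailCount R n k = 0 := by
  rw [tailCount, Set.ncard_eq_zero]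
  refine Set.eq_empty_of_forall_notMem fun σ ⟨_, j, h, h', h''⟩ => by omega

theorem forkCount_one_one (R : ℕ → ℕ → ℕ → ℕ → Prop) : forkCount R 1 1 = 1 := by
  rw [forkCount, Set.ncard_eq_one]
  refine ⟨1, Set.eq_singleton_iff_unique_mem.2 ⟨⟨?_, ?_⟩, fun σ _ => Subsingleton.elim _ _⟩⟩
  · intro a b c d hab
    exact absurd (Subsingleton.elim a b) hab.ne
  · rw [hasHead_succ]; simp

theorem tailCount_eq_add (R : ℕ → ℕ → ℕ → ℕ → Prop) (n k : ℕ) :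
    tailCount R n k = forkCount R n (k + 1) + tailCount R n (k + 1) := by
  rw [tailCount, forkCount, tailCount, ← Set.ncard_union_eq]
  · congr 1
    ext σ
    simp only [Set.mem_union, Set.mem_ofPred_eq, ← and_or_left]
    refine and_congr_right fun _ => ⟨?_, ?_⟩
    · rintro ⟨j, hj, h⟩
      rcases (Nat.succ_le_of_lt hj).eq_or_lt with rfl | hj
      · exact Or.inl h
      · exact Or.inr ⟨j, hj, h⟩
    · rintro (h | ⟨j, hj, h⟩)
      · exact ⟨k + 1, k.lt_succ_self, h⟩
      · exact ⟨j, by omega, h⟩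
  · refine Set.disjoint_left.2 ?_
    rintro σ ⟨_, h, h'⟩ ⟨_, j, hj, h₂, h₂'⟩
    omega

theorem insertAt_prod_injective {n : ℕ} (i : Fin (n + 1)) :
    Function.Injective fun p : Fin (n + 1) × Equiv.Perm (Fin n) => insertAt i p.1 p.2 := by
  rintro ⟨v, σ⟩ ⟨w, τ⟩ h
  have hv : v = w := by simpa using DFunLike.congr_fun h i
  subst hv
  exact congrArg (Prod.mk v) (insertAt_injective i v h)

/-- The zero-based first letter is `k`. An initial ascent loses its first letter, leaving a head
above `k`; an initial descent loses its second letter, which lowers the one-based head from `k + 1`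
to `k`. -/
theorem forkCount_succ_succ (hR : IsForkRelation R) {n k : ℕ} (hk : k < n + 2) :
    forkCount R (n + 2) (k + 1) =
      tailCount R (n + 1) k + (descentValues R n k).ncard * forkCount R (n + 1) k := by
  have h10 : (1 : Fin (n + 2)).succAbove 0 = 0 := rfl
  have h01 : (0 : Fin (n + 2)).succAbove 0 = 1 := rfl
  rw [tailCount, forkCount, forkCount, ← Set.ncard_prod,
    ← Set.ncard_image_of_injective _ (insertAt_injective 0 ⟨k, hk⟩),
    ← Set.ncard_image_of_injective _ (insertAt_prod_injective 1), ← Set.ncard_union_eq]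
  · congr 1
    ext σ
    simp only [Set.mem_union, Set.mem_ofPred_eq, Set.mem_image, hasHead_succ, Set.mem_prod,
      Prod.exists, descentValues]
    constructor
    · rintro ⟨hσ, h0⟩
      replace h0 : σ 0 = ⟨k, hk⟩ := Fin.ext (by simpa using h0)
      have hne : (σ 0 : ℕ) ≠ σ 1 := apply_ne σ (by simp)
      rcases hne.lt_or_gt with hlt | hgt
      · left
        obtain ⟨τ, rfl⟩ := exists_insertAt_eq h0
        rw [insertAt_self, ← h01, insertAt_succAbove, val_succAbove, lt_bump_iff] at hlt
        exact ⟨τ, ⟨(forkFree_insertAt_zero hR hlt).1 hσ, _, by simp at hlt; omega, rfl⟩, rfl⟩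
      · right
        obtain ⟨τ, hτ⟩ := exists_insertAt_eq (rfl : σ 1 = σ 1)
        have hb : bump (σ 1) (τ 0) = k := by
          rw [← val_succAbove, ← insertAt_succAbove 1, h10, hτ, h0]
        rw [h0] at hgt
        have hlt : (σ 1 : ℕ) < bump (σ 1) (τ 0) := by rw [hb]; exact hgt
        have hle := lt_bump_iff.1 hlt
        rw [bump, if_neg (by omega)] at hb
        rw [← hτ, forkFree_insertAt_one hR hle, hb] at hσ
        exact ⟨σ 1, τ, ⟨⟨hgt, hσ.2⟩, hσ.1, hb⟩, hτ⟩
    · rintro (⟨τ, ⟨h, j, hj, rfl⟩, rfl⟩ | ⟨v, τ, ⟨⟨hv, hV⟩, h, rfl⟩, rfl⟩)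
      · exact ⟨(forkFree_insertAt_zero hR (Nat.le_of_lt_succ hj)).2 h, by simp⟩
      · refine ⟨(forkFree_insertAt_one hR (by omega)).2 ⟨h, hV⟩, ?_⟩
        rw [← h10, insertAt_succAbove, val_succAbove, bump, if_neg (by omega)]
  · refine Set.disjoint_left.2 ?_
    rintro _ ⟨τ, ⟨h, j, hj, hτ⟩, rfl⟩ ⟨⟨v, τ'⟩, ⟨⟨hv, hV⟩, h'⟩, he⟩
    rw [hasHead_succ] at hτ
    have := congrArg Fin.val (DFunLike.congr_fun he 1)
    simp only [insertAt_self] at this hv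
    rw [← h01, insertAt_succAbove, val_succAbove] at this
    have h2 : k < bump k (τ 0) := lt_bump_iff.2 (by omega)
    simp only at this
    omega

/-! ### Counting the descent values; recurrences -/

/-- Every fork relation for which exactly one letter (or two, if the first letter is maximal and
the length is at least three) can follow the first letter in a descent. -/
structure IsTame (R : ℕ → ℕ → ℕ → ℕ → Prop) : Prop extends IsForkRelation R where
  ncard_of_lt : ∀ {n k}, k < n → (descentValues R n (k + 1)).ncard = 1
  ncard_zero : (descentValues R 0 1).ncard = 1
  ncard_last : ∀ n, (descentValues R (n + 1) (n + 2)).ncard = 2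

/-- The second letter must be the least or the greatest of the letters other than `k`; the greatest
is below `k` only if `k` is maximal. -/
theorem isTame_fork₁ : IsTame Fork₁ where
  toIsForkRelation := isForkRelation_fork₁
  ncard_of_lt {n k} hk := by
    rw [Set.ncard_eq_one]
    refine ⟨0, Set.eq_singleton_iff_unique_mem.2 ⟨⟨by simp, by simp [Fork₁]⟩, ?_⟩⟩
    rintro v ⟨hv, h⟩
    by_contra hne
    have := Fin.val_ne_zero_iff.2 hne
    exact h 0 (n + 1) (by omega) (by omega) (by omega) (by omega) ⟨by omega, by omega, hv⟩
  ncard_zero := by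
    rw [Set.ncard_eq_one]
    refine ⟨0, Set.eq_singleton_iff_unique_mem.2 ⟨⟨by simp, by simp [Fork₁]⟩, ?_⟩⟩
    rintro v ⟨hv, h⟩
    ext; simpa using hv
  ncard_last n := by
    rw [Set.ncard_eq_two]
    refine ⟨0, ⟨n + 1, by omega⟩, by simp [Fin.ext_iff], ?_⟩
    ext v
    simp only [descentValues, Fork₁, Set.mem_ofPred_eq, Set.mem_insert_iff,
      Set.mem_singleton_iff, Fin.ext_iff, Fin.val_zero]
    constructor
    · rintro ⟨hv, h⟩
      by_contra! hne
      exact h 0 (n + 1) (by omega) (by omega) (by omega) (by omega) ⟨by omega, by omega, hv⟩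
    · rintro h
      exact ⟨by omega, by omega⟩

/-- No letter strictly between `v` and `k` may have a larger letter other than `k`. This forces `v =
k - 1`, with `v = k - 2` also possible when `k` is maximal. -/
theorem isTame_fork₂ : IsTame Fork₂ where
  toIsForkRelation := isForkRelation_fork₂
  ncard_of_lt {n k} hk := by
    rw [Set.ncard_eq_one]
    refine ⟨⟨k, by omega⟩, Set.eq_singleton_iff_unique_mem.2 ⟨⟨by simp, ?_⟩, ?_⟩⟩
    · simp only [Fork₂]; omega
    rintro v ⟨hv, h⟩
    by_contra hne
    rw [Fin.ext_iff] at hne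
    simp only at hne
    exact h k (n + 1) (by omega) (by omega) (by omega) (by omega) ⟨by omega, by omega, by omega⟩
  ncard_zero := by
    rw [Set.ncard_eq_one]
    refine ⟨0, Set.eq_singleton_iff_unique_mem.2 ⟨⟨by simp, ?_⟩, ?_⟩⟩
    · simp only [Fork₂]; omega
    rintro v ⟨hv, h⟩
    ext; simpa using hv
  ncard_last n := by
    rw [Set.ncard_eq_two]
    refine ⟨⟨n, by omega⟩, ⟨n + 1, by omega⟩, by simp [Fin.ext_iff], ?_⟩
    ext v
    simp only [descentValues, Fork₂, Set.mem_ofPred_eq, Set.mem_insert_iff,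
      Set.mem_singleton_iff, Fin.ext_iff]
    constructor
    · rintro ⟨hv, h⟩
      by_contra! hne
      exact h n (n + 1) (by omega) (by omega) (by omega) (by omega)
        ⟨by omega, by omega, by omega⟩
    · rintro h
      exact ⟨by omega, by omega⟩

theorem forkCount_two_two (hR : IsTame R) : forkCount R 2 2 = 1 := by
  rw [forkCount_succ_succ hR.1 (by omega), tailCount_eq_zero_of_le R le_rfl, hR.ncard_zero,
    forkCount_one_one]

theorem forkCount_diag (hR : IsTame R) (n : ℕ) : forkCount R (n + 2) (n + 2) = 2 ^ n := by
  induction n with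
  | zero => exact forkCount_two_two hR
  | succ n ih =>
    rw [forkCount_succ_succ hR.1 (by omega), tailCount_eq_zero_of_le R le_rfl, hR.ncard_last, ih]
    ring

/-- At `k = 0` there are no descent values, but the count vanishes too, so the factor can be dropped
uniformly. -/
theorem ncard_mul_forkCount (hR : IsTame R) {n k : ℕ} (hk : k ≤ n) :
    (descentValues R n k).ncard * forkCount R (n + 1) k = forkCount R (n + 1) k := by
  rcases k with _ | k
  · rw [forkCount_zero_right, mul_zero]
  · rw [hR.ncard_of_lt (by omega), one_mul]

theorem forkCount_recurrence (hR : IsTame R) {n k : ℕ} (hk : k < n) :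
    forkCount R (n + 2) (k + 2) + forkCount R (n + 1) k = forkCount R (n + 2) (k + 1) := by
  rw [forkCount_succ_succ hR.1 (by omega), forkCount_succ_succ hR.1 (by omega),
    ncard_mul_forkCount hR (by omega), ncard_mul_forkCount hR (by omega), tailCount_eq_add R _ k]
  ring

/-- The second descent value of a maximal head contributes the extra `2 ^ n`. -/
theorem forkCount_recurrence_last (hR : IsTame R) (n : ℕ) :
    forkCount R (n + 3) (n + 3) + forkCount R (n + 2) (n + 1) =
      forkCount R (n + 3) (n + 2) + 2 ^ n := by
  rw [forkCount_diag hR, forkCount_succ_succ (n := n + 1) (k := n + 1) hR.1 (by omega),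
    ncard_mul_forkCount hR (by omega), tailCount_eq_add R (n + 2) (n + 1), forkCount_diag hR,
    tailCount_eq_zero_of_le R le_rfl]
  ring

theorem forkCount_two_one (hR : IsTame R) : forkCount R 2 1 = 1 := by
  rw [forkCount_succ_succ hR.1 (by omega), ncard_mul_forkCount hR (by omega), tailCount_eq_add,
    forkCount_one_one, tailCount_eq_zero_of_le R le_rfl, forkCount_zero_right]

/-! ### Coefficients in two variables -/

open Finsupp (single)

/-- The coefficient of `x ^ n * y ^ k`. -/
noncomputable def coeffXY (n k : ℕ) : MvPowerSeries (Fin 2) ℚ →ₗ[ℚ] ℚ :=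
  MvPowerSeries.coeff (single 0 n + single 1 k)

theorem single_add_single (m : Fin 2 →₀ ℕ) : single 0 (m 0) + single 1 (m 1) = m := by
  ext i; fin_cases i <;> simp

theorem coeff_eq_coeffXY (m : Fin 2 →₀ ℕ) (φ : MvPowerSeries (Fin 2) ℚ) :
    MvPowerSeries.coeff m φ = coeffXY (m 0) (m 1) φ := by
  rw [coeffXY, single_add_single]

theorem ext_coeffXY {φ ψ : MvPowerSeries (Fin 2) ℚ} (h : ∀ n k, coeffXY n k φ = coeffXY n k ψ) :
    φ = ψ := by
  ext m
  rw [coeff_eq_coeffXY, coeff_eq_coeffXY, h]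

theorem coeffXY_one (n k : ℕ) : coeffXY n k 1 = if n = 0 ∧ k = 0 then 1 else 0 := by
  classical
  rw [coeffXY, MvPowerSeries.coeff_one]
  congr 1
  simp

theorem coeffXY_succ_x_mul (n k : ℕ) (φ : MvPowerSeries (Fin 2) ℚ) :
    coeffXY (n + 1) k (x * φ) = coeffXY n k φ := by
  rw [coeffXY, coeffXY, x, MvPowerSeries.X, ← one_mul (MvPowerSeries.coeff _ φ),
    ← MvPowerSeries.coeff_add_monomial_mul, ← add_assoc, ← Finsupp.single_add, add_comm 1 n]

theorem coeffXY_zero_x_mul (k : ℕ) (φ : MvPowerSeries (Fin 2) ℚ) :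
    coeffXY 0 k (x * φ) = 0 := by
  rw [coeffXY, x, MvPowerSeries.X, MvPowerSeries.coeff_monomial_mul, if_neg]
  intro h
  simpa using h 0

theorem coeffXY_succ_y_mul (n k : ℕ) (φ : MvPowerSeries (Fin 2) ℚ) :
    coeffXY n (k + 1) (y * φ) = coeffXY n k φ := by
  rw [coeffXY, coeffXY, y, MvPowerSeries.X, ← one_mul (MvPowerSeries.coeff _ φ),
    ← MvPowerSeries.coeff_add_monomial_mul, add_left_comm, ← Finsupp.single_add, add_comm 1 k]

theorem coeffXY_zero_y_mul (n : ℕ) (φ : MvPowerSeries (Fin 2) ℚ) :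
    coeffXY n 0 (y * φ) = 0 := by
  rw [coeffXY, y, MvPowerSeries.X, MvPowerSeries.coeff_monomial_mul, if_neg]
  intro h
  simpa using h 1

/-! ### Series supported in a submonoid of exponents -/

/-- The ring of formal power series whose support lies in the submonoid `M`. -/
def supportedIn {σ : Type*} (M : AddSubmonoid (σ →₀ ℕ)) : Subring (MvPowerSeries σ ℚ) where
  carrier := {φ | ∀ m ∉ M, MvPowerSeries.coeff m φ = 0}
  mul_mem' {φ ψ} hφ hψ m hm := by
    classical
    rw [MvPowerSeries.coeff_mul]
    refine Finset.sum_eq_zero fun p hp => ?_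
    rw [Finset.HasAntidiagonal.mem_antidiagonal] at hp
    by_cases h : p.1 ∈ M
    · rw [hψ p.2 fun h' => hm (hp ▸ M.add_mem h h'), mul_zero]
    · rw [hφ _ h, zero_mul]
  one_mem' m hm := by
    classical
    rw [MvPowerSeries.coeff_one, if_neg]
    rintro rfl
    exact hm M.zero_mem
  add_mem' hφ hψ m hm := by rw [map_add, hφ m hm, hψ m hm, add_zero]
  zero_mem' m _ := map_zero _
  neg_mem' hφ m hm := by rw [map_neg, hφ m hm, neg_zero]

theorem supportedIn_mono {σ : Type*} {M N : AddSubmonoid (σ →₀ ℕ)} (h : M ≤ N) :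
    supportedIn M ≤ supportedIn N := fun _ hφ m hm => hφ m fun h' => hm (h h')

theorem X_mem_supportedIn {σ : Type*} {M : AddSubmonoid (σ →₀ ℕ)} {i : σ}
    (h : single i 1 ∈ M) : (MvPowerSeries.X i : MvPowerSeries σ ℚ) ∈ supportedIn M := by
  classical
  intro m hm
  rw [MvPowerSeries.coeff_X, if_neg]
  rintro rfl
  exact hm h

/-- If `a + b = m ∉ M` and `a ∈ M`, then `b ∉ M`, of smaller degree unless `a = 0`; induction on the
degree leaves only the constant term of `φ` times the coefficient at `m`. -/
theorem mem_supportedIn_of_mul_mem {σ : Type*} {M : AddSubmonoid (σ →₀ ℕ)}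
    {φ ψ : MvPowerSeries σ ℚ} (hφ : φ ∈ supportedIn M)
    (h0 : MvPowerSeries.constantCoeff φ ≠ 0) (h : φ * ψ ∈ supportedIn M) :
    ψ ∈ supportedIn M := by
  classical
  intro m
  induction hd : m.degree using Nat.strong_induction_on generalizing m with
  | _ d ih =>
    intro hm
    have key := h m hm
    rw [MvPowerSeries.coeff_mul, Finset.sum_eq_single (0, m)] at key
    · simpa [h0] using key
    · rintro ⟨a, b⟩ hp hne
      rw [Finset.HasAntidiagonal.mem_antidiagonal] at hp
      simp only at hp ⊢
      by_cases ha : a ∈ M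
      · have hb : b ∉ M := fun hb => hm (hp ▸ M.add_mem ha hb)
        have ha0 : a.degree ≠ 0 := by
          rw [Ne, Finsupp.degree_eq_zero_iff]
          rintro rfl
          exact hne (by rw [← hp, zero_add])
        have hdeg : a.degree + b.degree = m.degree := by rw [← hp, map_add]
        rw [ih b.degree (by omega) b rfl hb, mul_zero]
      · rw [hφ a ha, zero_mul]
    · intro h; simp at h

theorem inv_mem_supportedIn {σ : Type*} {M : AddSubmonoid (σ →₀ ℕ)} {φ : MvPowerSeries σ ℚ}
    (hφ : φ ∈ supportedIn M) (h0 : MvPowerSeries.constantCoeff φ ≠ 0) : φ⁻¹ ∈ supportedIn M := by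
  refine mem_supportedIn_of_mul_mem hφ h0 ?_
  rw [MvPowerSeries.mul_inv_cancel _ h0]
  exact one_mem _

/-- The exponents of monomials in `x` alone. -/
def xExponents : AddSubmonoid (Fin 2 →₀ ℕ) where
  carrier := {m | m 1 = 0}
  add_mem' {a b} ha hb := by simp_all
  zero_mem' := rfl

/-- The exponents of monomials `x ^ n * y ^ k` with `k ≤ n`. -/
def lowerExponents : AddSubmonoid (Fin 2 →₀ ℕ) where
  carrier := {m | m 1 ≤ m 0}
  add_mem' {a b} (ha : a 1 ≤ a 0) (hb : b 1 ≤ b 0) := show a 1 + b 1 ≤ a 0 + b 0 by omega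
  zero_mem' := le_refl (0 : ℕ)

theorem mem_lowerExponents {m : Fin 2 →₀ ℕ} : m ∈ lowerExponents ↔ m 1 ≤ m 0 := Iff.rfl

theorem mem_xExponents {m : Fin 2 →₀ ℕ} : m ∈ xExponents ↔ m 1 = 0 := Iff.rfl

theorem xExponents_le : xExponents ≤ lowerExponents := fun m h => by
  rw [mem_xExponents] at h
  rw [mem_lowerExponents, h]
  exact Nat.zero_le _

theorem x_mem : x ∈ supportedIn xExponents :=
  X_mem_supportedIn (show (single 0 1 : Fin 2 →₀ ℕ) 1 = 0 by simp)

theorem mem_lower_iff {φ : MvPowerSeries (Fin 2) ℚ} :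
    φ ∈ supportedIn lowerExponents ↔ ∀ n k, n < k → coeffXY n k φ = 0 := by
  refine ⟨fun h n k hnk => h _ ?_, fun h m hm => ?_⟩
  · rw [mem_lowerExponents]
    simpa using hnk
  · rw [coeff_eq_coeffXY]
    exact h _ _ (not_le.1 fun h => hm (mem_lowerExponents.2 h))

theorem coeffXY_eq_zero_of_mem {φ : MvPowerSeries (Fin 2) ℚ} (h : φ ∈ supportedIn xExponents)
    (n k : ℕ) : coeffXY n (k + 1) φ = 0 := by
  refine h _ ?_
  rw [mem_xExponents]
  simp

theorem x_mul_y_mem : x * y ∈ supportedIn lowerExponents := by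
  rw [mem_lower_iff]
  intro n k h
  obtain ⟨k, rfl⟩ : ∃ j, k = j + 1 := ⟨k - 1, by omega⟩
  rcases n with _ | n
  · exact coeffXY_zero_x_mul _ _
  · rw [coeffXY_succ_x_mul, ← mul_one y, coeffXY_succ_y_mul, coeffXY_one, if_neg (by omega)]

/-! ### Uniqueness for the kernel equation -/

/-- A series supported in `k ≤ n` without terms in `y ^ 0` is determined by the coefficients of
`y ^ 2, y ^ 3, …` of its product with the kernel. -/
theorem eq_zero_of_kernel_mul {φ : MvPowerSeries (Fin 2) ℚ}
    (hφ : φ ∈ supportedIn lowerExponents) (h0 : ∀ n, coeffXY n 0 φ = 0)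
    (h : ∀ n k, coeffXY n (k + 2) ((1 - y + x * y ^ 2) * φ) = 0) : φ = 0 := by
  rw [mem_lower_iff] at hφ
  have hk (n k : ℕ) : coeffXY n (k + 2) φ - coeffXY n (k + 1) φ +
      coeffXY n (k + 2) (x * (y * (y * φ))) = 0 := by
    rw [← h n k, show (1 - y + x * y ^ 2) * φ = φ - y * φ + x * (y * (y * φ)) by ring, map_add,
      map_sub, coeffXY_succ_y_mul]
  refine ext_coeffXY fun n => ?_
  simp only [map_zero]
  induction n with
  | zero =>
    intro k
    rcases k with _ | k
    · exact h0 0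
    · exact hφ 0 _ (by omega)
  | succ n ih =>
    -- Once row `n` vanishes, row `n + 1` is constant for `k ≥ 1`, and the support condition makes
    -- it zero far out.
    have step (k : ℕ) : coeffXY (n + 1) (k + 1) φ = coeffXY (n + 1) (k + 2) φ := by
      have := hk (n + 1) k
      rw [coeffXY_succ_x_mul, coeffXY_succ_y_mul, coeffXY_succ_y_mul, ih] at this
      linarith
    have far (j k : ℕ) : coeffXY (n + 1) (k + 1) φ = coeffXY (n + 1) (k + j + 1) φ := by
      induction j with
      | zero => rfl
      | succ j ih => rw [ih, step]; rfl
    intro k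
    rcases k with _ | k
    · exact h0 _
    · rw [far (n + 1), hφ _ _ (by omega)]

/-! ### The diagonal, Catalan and square root series -/

/-- The geometric series in `2 * x * y`. -/
noncomputable def geom : MvPowerSeries (Fin 2) ℚ :=
  fun m => if m 0 = m 1 then 2 ^ m 0 else 0

theorem coeffXY_geom (n k : ℕ) : coeffXY n k geom = if n = k then 2 ^ n else 0 := by
  change geom _ = _
  simp [geom]

theorem geom_mul : geom * (1 - 2 * x * y) = 1 := by
  rw [show geom * (1 - 2 * x * y) = geom - (x * (y * geom) + x * (y * geom)) by ring]
  refine ext_coeffXY fun n k => ?_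
  rw [map_sub, map_add, coeffXY_one, coeffXY_geom]
  rcases n with _ | n
  · simp [coeffXY_zero_x_mul, eq_comm]
  · rcases k with _ | k
    · simp [coeffXY_succ_x_mul, coeffXY_zero_y_mul]
    · simp only [coeffXY_succ_x_mul, coeffXY_succ_y_mul, coeffXY_geom, Nat.add_right_cancel_iff]
      by_cases h : n = k
      · simp [h]; ring
      · simp [h]

/-- The part of the kernel equation that lies on the diagonal. -/
noncomputable def diagSeries : MvPowerSeries (Fin 2) ℚ :=
  x * (y * (1 + x * (y * (x * (y * geom)))))

theorem diagSeries_mul : diagSeries * (1 - 2 * x * y) = x * y * (x * y - 1) ^ 2 := by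
  unfold diagSeries
  linear_combination (x * y) ^ 3 * geom_mul

/-- The sequence of diagonal coefficients. -/
def diagCoeff : ℕ → ℚ
  | 1 => 1
  | n + 3 => 2 ^ n
  | _ => 0

/-- `diagCoeff n` is the jump `f(n, n) - f(n - 1, n - 1)` of the diagonal counts `0, 1, 1, 2, 4, …`.
-/
theorem coeffXY_diagSeries (n k : ℕ) :
    coeffXY n k diagSeries = if n = k then diagCoeff n else 0 := by
  unfold diagSeries
  rcases n with _ | _ | _ | n <;> rcases k with _ | _ | _ | k <;>
    simp [coeffXY_zero_x_mul, coeffXY_zero_y_mul, coeffXY_succ_x_mul, coeffXY_succ_y_mul,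
      coeffXY_one, coeffXY_geom, diagCoeff]

/-- The Catalan series in `x`. -/
noncomputable def catalanX : MvPowerSeries (Fin 2) ℚ :=
  MvPowerSeries.rename (fun _ : Unit => (0 : Fin 2))
    (PowerSeries.map (Nat.castRingHom ℚ) PowerSeries.catalanSeries)

theorem catalanX_sq : x * catalanX ^ 2 + 1 = catalanX := by
  have h := congrArg (MvPowerSeries.rename (R := ℚ) (fun _ : Unit => (0 : Fin 2)))
    (congrArg (PowerSeries.map (Nat.castRingHom ℚ)) PowerSeries.catalanSeries_sq_mul_X_add_one)
  rw [map_add, map_mul, map_pow, map_one, PowerSeries.map_X, map_add, map_mul, map_pow, map_one,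
    PowerSeries.X, MvPowerSeries.rename_X, mul_comm] at h
  exact h

theorem catalanX_mem : catalanX ∈ supportedIn xExponents := by
  intro m hm
  refine MvPowerSeries.coeff_rename_eq_zero _ _ ?_
  rintro ⟨a, rfl⟩
  refine hm ?_
  rw [mem_xExponents]
  exact Finsupp.mapDomain_of_notMem_range _ _ (by simp)

theorem isSqrt_catalanX : IsSqrtOneSubFourX (1 - 2 * x * catalanX) := by
  refine ⟨by linear_combination 4 * x * catalanX_sq, by simp [x]⟩

theorem IsSqrtOneSubFourX.eq {r s : MvPowerSeries (Fin 2) ℚ} (hr : IsSqrtOneSubFourX r)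
    (hs : IsSqrtOneSubFourX s) : r = s := by
  have h : (r - s) * (r + s) = 0 := by linear_combination hr.1 - hs.1
  rcases mul_eq_zero.1 h with h | h
  · exact sub_eq_zero.1 h
  · have := congrArg MvPowerSeries.constantCoeff h
    rw [map_add, hr.2, hs.2, map_zero] at this
    norm_num at this

/-! ### The kernel equation for the counting series -/

/-- The formal power series whose coefficient at `x ^ n * y ^ k` is `forkCount R n k`. -/
noncomputable def forkSeries (R : ℕ → ℕ → ℕ → ℕ → Prop) : MvPowerSeries (Fin 2) ℚ :=
  fun m => (forkCount R (m 0) (m 1) : ℚ)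

theorem coeffXY_forkSeries (n k : ℕ) : coeffXY n k (forkSeries R) = forkCount R n k := by
  change forkSeries R _ = _
  simp [forkSeries]

theorem headSeries_T₁ : headSeries T₁ = forkSeries Fork₁ := by
  funext m
  rw [headSeries, forkSeries, headCount_T₁]

theorem headSeries_T₂ : headSeries T₂ = forkSeries Fork₂ := by
  funext m
  rw [headSeries, forkSeries, headCount_T₂]

theorem forkSeries_mem : forkSeries R ∈ supportedIn lowerExponents := by
  rw [mem_lower_iff]
  intro n k h
  rw [coeffXY_forkSeries, forkCount_eq_zero_of_lt R h, Nat.cast_zero]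

/-- Nonzero terms sit only at `k + 2 = n`, from the excess for a maximal head, and at `k + 2 = n +
1`, where the vanishing of `f(n, n + 1)` leaves minus the diagonal jump. -/
theorem coeffXY_kernel_mul_forkSeries (hR : IsTame R) (n k : ℕ) :
    coeffXY n (k + 2) ((1 - y + x * y ^ 2) * forkSeries R) =
      coeffXY n (k + 2) ((1 - y) * diagSeries) := by
  have zero {n k : ℕ} (h : n < k) : (forkCount R n k : ℚ) = 0 := by
    rw [forkCount_eq_zero_of_lt R h, Nat.cast_zero]
  rw [show (1 - y + x * y ^ 2) * forkSeries R =
      forkSeries R - y * forkSeries R + x * (y * (y * forkSeries R)) by ring,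
    show (1 - y) * diagSeries = diagSeries - y * diagSeries by ring,
    map_add, map_sub, map_sub, coeffXY_succ_y_mul, coeffXY_succ_y_mul]
  simp only [coeffXY_forkSeries, coeffXY_diagSeries]
  rcases n with _ | _ | n
  · rw [coeffXY_zero_x_mul, zero (by omega), zero (by omega), if_neg (by omega),
      if_neg (by omega)]
    ring
  · rw [coeffXY_succ_x_mul, coeffXY_succ_y_mul, coeffXY_succ_y_mul, coeffXY_forkSeries,
      zero (k := k + 2) (by omega), if_neg (by omega)]
    rcases k with _ | k
    · rw [forkCount_zero_right, forkCount_one_one]; simp [diagCoeff]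
    · rw [zero (by omega), zero (by omega), if_neg (by omega)]; ring
  · rw [coeffXY_succ_x_mul, coeffXY_succ_y_mul, coeffXY_succ_y_mul, coeffXY_forkSeries]
    rcases lt_trichotomy k n with h | rfl | h
    · rw [if_neg (by omega), if_neg (by omega), ← forkCount_recurrence hR h]
      push_cast; ring
    · rw [if_pos rfl, if_neg (by omega)]
      rcases k with _ | k
      · rw [forkCount_diag hR, forkCount_two_one hR, forkCount_zero_right]
        simp [diagCoeff]
      · have := congrArg (Nat.cast (R := ℚ)) (forkCount_recurrence_last hR k)
        push_cast at this
        simp only [diagCoeff]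
        linarith
    · rw [zero (k := k + 2) (by omega), if_neg (by omega)]
      rcases (Nat.succ_le_of_lt h).eq_or_lt with rfl | h
      · rw [if_pos rfl]
        rcases n with _ | n
        · rw [forkCount_two_two hR, forkCount_one_one]; simp [diagCoeff]
        · rw [forkCount_diag hR, forkCount_diag hR]
          simp only [diagCoeff]
          push_cast; ring
      · rw [zero (by omega), zero (by omega), if_neg (by omega)]; ring

/-! ### Cancelling the bad kernel factor; the closed form -/

/-- The part of the denominator that remains after cancelling `1 - y / C`, where `C` is the Catalan
series. -/
noncomputable def reducedDenom : MvPowerSeries (Fin 2) ℚ :=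
  (1 - x * y * catalanX) * (1 - 2 * (x * y)) * (1 - 2 * x * catalanX)

/-- The numerator that remains after cancelling `1 - y / C`, where `C` is the Catalan series. -/
noncomputable def reducedNum : MvPowerSeries (Fin 2) ℚ :=
  1 - 2 * x * catalanX + x +
    x * y * (1 - catalanX * (1 - 2 * x * catalanX) - x * catalanX - 2 * (1 - 2 * x * catalanX) -
      2 * x) +
    (x * y) ^ 2 * (1 - 2 * x * catalanX) * catalanX

/-- Here `1 - x * catalanX` is `1 / C`. Only the first factor has terms with more `y` than `x`. -/
theorem kernel_eq : 1 - y + x * y ^ 2 = (1 - y * (1 - x * catalanX)) * (1 - x * y * catalanX) := by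
  linear_combination x * y ^ 2 * catalanX_sq

/-- The numerator vanishes at the kernel root `y = C`, so the factor `1 - y / C` cancels. -/
theorem numerator_eq :
    (x * y - 1) ^ 2 * (1 - y) * (1 - 2 * x * catalanX) + x * (1 - 2 * x * y) =
      (1 - y * (1 - x * catalanX)) * reducedNum := by
  unfold reducedNum
  linear_combination (y ^ 2 * (x - 2 * x ^ 2 * catalanX - x ^ 2) -
    y ^ 3 * x ^ 2 * (1 - 2 * x * catalanX)) * catalanX_sq

theorem constantCoeff_reducedDenom : MvPowerSeries.constantCoeff reducedDenom = 1 := by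
  simp [reducedDenom, x, y]

theorem reduced_mem :
    reducedDenom ∈ supportedIn lowerExponents ∧ reducedNum ∈ supportedIn lowerExponents := by
  have hC := supportedIn_mono xExponents_le catalanX_mem
  have hx := supportedIn_mono xExponents_le x_mem
  have ht := x_mul_y_mem
  have h2 : (2 : MvPowerSeries (Fin 2) ℚ) ∈ supportedIn lowerExponents := ofNat_mem _ 2
  have hs := sub_mem (one_mem _) (mul_mem (mul_mem h2 hx) hC)
  constructor
  · exact mul_mem (mul_mem (sub_mem (one_mem _) (mul_mem ht hC))
      (sub_mem (one_mem _) (mul_mem h2 ht))) hs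
  · refine add_mem (add_mem (add_mem hs hx) (mul_mem ht ?_))
      (mul_mem (mul_mem (pow_mem ht 2) hs) hC)
    exact sub_mem (sub_mem (sub_mem (sub_mem (one_mem _) (mul_mem hC hs)) (mul_mem hx hC))
      (mul_mem h2 hs)) (mul_mem h2 hx)

/-- The closed form of the generating function. -/
theorem forkSeries_mul_reducedDenom (hR : IsTame R) :
    forkSeries R * reducedDenom = x * y * reducedNum := by
  have h1 : MvPowerSeries.constantCoeff reducedDenom ≠ 0 := by
    rw [constantCoeff_reducedDenom]; exact one_ne_zero
  have hs : MvPowerSeries.constantCoeff (1 - 2 * x * catalanX) ≠ 0 := by simp [x]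
  have hsmem : 1 - 2 * x * catalanX ∈ supportedIn xExponents :=
    sub_mem (one_mem _) (mul_mem (mul_mem (ofNat_mem _ 2) x_mem) catalanX_mem)
  have hinv := MvPowerSeries.mul_inv_cancel _ hs
  have hinvmem := inv_mem_supportedIn hsmem hs
  set r := (1 - 2 * x * catalanX)⁻¹
  -- The last term, `x ^ 2 * y / √(1 - 4x)`, has `y`-degree one, so the coefficients of `y ^ 2, y ^
  -- 3, …` do not see it.
  have hker : (1 - y + x * y ^ 2) * (x * y * reducedNum * reducedDenom⁻¹) =
      (1 - y) * diagSeries + y * (x * (x * r)) := by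
    have hne : reducedDenom ≠ 0 := fun h => h1 (by rw [h, map_zero])
    refine mul_right_cancel₀ hne ?_
    have hD : reducedDenom = (1 - x * y * catalanX) * (1 - 2 * (x * y)) *
      (1 - 2 * x * catalanX) := rfl
    linear_combination (1 - y + x * y ^ 2) * (x * y) * reducedNum *
        MvPowerSeries.inv_mul_cancel _ h1 + x * y * reducedNum * kernel_eq -
      x * y * (1 - x * y * catalanX) * numerator_eq -
      ((1 - y) * diagSeries + y * (x * (x * r))) * hD -
      (1 - y) * (1 - x * y * catalanX) * (1 - 2 * x * catalanX) * diagSeries_mul -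
      y * x ^ 2 * (1 - 2 * x * y) * (1 - x * y * catalanX) * hinv
  rw [← MvPowerSeries.eq_mul_inv_iff_mul_eq h1, ← sub_eq_zero]
  refine eq_zero_of_kernel_mul ?_ (fun n => ?_) fun n k => ?_
  · refine sub_mem forkSeries_mem (mul_mem (mul_mem x_mul_y_mem reduced_mem.2) ?_)
    exact inv_mem_supportedIn reduced_mem.1 h1
  · rw [map_sub, coeffXY_forkSeries, forkCount_zero_right,
      show x * y * reducedNum * reducedDenom⁻¹ = y * (x * reducedNum * reducedDenom⁻¹) by ring,
      coeffXY_zero_y_mul]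
    simp
  · rw [mul_sub, hker, map_sub, map_add, coeffXY_kernel_mul_forkSeries hR, coeffXY_succ_y_mul,
      coeffXY_eq_zero_of_mem (mul_mem x_mem (mul_mem x_mem hinvmem))]
    ring

theorem forkSeries_eq (hR : IsTame R) {r : MvPowerSeries (Fin 2) ℚ} (hr : IsSqrtOneSubFourX r) :
    IsUnit ((1 - y + x * y ^ 2) * (1 - 2 * x * y) * r) ∧
    forkSeries R = (x * y * ((x * y - 1) ^ 2 * (1 - y) * r + x * (1 - 2 * x * y))) *
      ((1 - y + x * y ^ 2) * (1 - 2 * x * y) * r)⁻¹ := by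
  have h1 : MvPowerSeries.constantCoeff ((1 - y + x * y ^ 2) * (1 - 2 * x * y) * r) = 1 := by
    simp [x, y, hr.2]
  refine ⟨MvPowerSeries.isUnit_iff_constantCoeff.2 (h1 ▸ isUnit_one), ?_⟩
  rw [MvPowerSeries.eq_mul_inv_iff_mul_eq (h1 ▸ one_ne_zero), hr.eq isSqrt_catalanX, numerator_eq,
    kernel_eq]
  have h := forkSeries_mul_reducedDenom hR
  unfold reducedDenom at h
  linear_combination (1 - y * (1 - x * catalanX)) * h

end FirstElement

theorem theorem11 :
    (∃! r : MvPowerSeries (Fin 2) ℚ, FirstElement.IsSqrtOneSubFourX r) ∧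
    ∀ r : MvPowerSeries (Fin 2) ℚ, FirstElement.IsSqrtOneSubFourX r →
      ∀ x y : MvPowerSeries (Fin 2) ℚ, x = FirstElement.x → y = FirstElement.y →
        IsUnit ((1 - y + x * y ^ 2) * (1 - 2 * x * y) * r) ∧
        FirstElement.headSeries FirstElement.T₁ =
          (x * y * ((x * y - 1) ^ 2 * (1 - y) * r + x * (1 - 2 * x * y))) *
            ((1 - y + x * y ^ 2) * (1 - 2 * x * y) * r)⁻¹ ∧
        FirstElement.headSeries FirstElement.T₂ =
          (x * y * ((x * y - 1) ^ 2 * (1 - y) * r + x * (1 - 2 * x * y))) *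
            ((1 - y + x * y ^ 2) * (1 - 2 * x * y) * r)⁻¹ := by
  refine ⟨⟨_, FirstElement.isSqrt_catalanX, fun r hr => hr.eq FirstElement.isSqrt_catalanX⟩, ?_⟩
  rintro r hr x y rfl rfl
  have h₁ := FirstElement.forkSeries_eq FirstElement.isTame_fork₁ hr
  have h₂ := FirstElement.forkSeries_eq FirstElement.isTame_fork₂ hr
  rw [FirstElement.headSeries_T₁, FirstElement.headSeries_T₂]
  exact ⟨h₁.1, h₁.2, h₂.2⟩
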